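/- Two base stations operate over slots $t=1,\dots,N$ with storage efficiency $\alpha$ and transfer efficiency $\beta$, $0\le\alpha\le1$, $0\le\beta\le1$, and storage capacity $S_{\max}\ge0$. Let $E(t)=(E_1(t),E_2(t))$, $1\le t\le N$, be real random variables (the net energies) with an arbitrary joint distribution. A policy chooses in each slot $t$, as a measurable function of $E(1),\dots,E(t)$, numbers $w_i,c_i,d_i,x_{12},x_{21}\ge0$ ($i=1,2$). With the storage dynamics $s_i(t+1)=s_i(t)+\alpha c_i(t)-d_i(t)$, it is admissible from slot $k$ and storage levels $s(k)\in[0,S_{\max}]^2$ if almost surely, for $k\le t\le N$ and $i=1,2$, $$d_i(t)\le s_i(t),\qquad 0\le s_i(t+1)\le S_{\max},$$ $$E_1(t)+w_1(t)-c_1(t)+\alpha d_1(t)-x_{12}(t)+\beta x_{21}(t)\ge0,\qquad E_2(t)+w_2(t)-c_2(t)+\alpha d_2(t)-x_{21}(t)+\beta x_{12}(t)\ge0.$$ A greedy policy is a policy that in each slot $t$, given $s(t)$ and $E(t)$, almost surely first minimizes $w_1(t)+w_2(t)$ over all choices satisfying these constraints of slot $t$ and, among the minimizers, maximizes $s_1(t+1)+s_2(t+1)$.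 Suppose that $\beta>\alpha$ and that $E_1(t)\ge0$ almost surely for all $1\le t\le N$. Then for every $1\le k\le N$ and every $s(k)\in[0,S_{\max}]^2$ a greedy policy exists, and it can be chosen such that almost surely $c_i(t)d_i(t)=0$ and $x_{12}(t)x_{21}(t)=0$ for all $k\le t\le N$ and $i=1,2$. Moreover, every greedy policy is optimal: it is admissible and minimizes the expected cost-to-go $$\mathbb E\Big(\sum_{t=k}^{N}(w_1(t)+w_2(t))\Big)\in[0,\infty]$$ over all admissible policies. The same holds if, instead, $E_2(t)\ge0$ almost surely for all $1\le t\le N$ (and $\beta>\alpha$). -/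

import Mathlib

open MeasureTheory

namespace EnergyCoop

/-- The control variables of one time slot. Base stations are indexed by `Fin 2`:
index `0` is BS 1 and index `1` is BS 2. -/
structure Action where
  /-- energy drawn from the conventional source (main grid) at each BS -/
  w : Fin 2 → ℝ
  /-- energy sent to the storage of each BS -/
  c : Fin 2 → ℝ
  /-- energy discharged from the storage of each BS -/
  d : Fin 2 → ℝ
  /-- energy sent by each BS to the other one: `x 0` is `x₁₂` and `x 1` is `x₂₁` -/
  x : Fin 2 → ℝ

/-- Total conventional energy drawn in one slot, `w₁ + w₂`. -/
def Action.grid (a : Action) : ℝ := a.w 0 + a.w 1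

/-- There is no simultaneous charging and discharging at a BS, and no simultaneous transfer in
both directions. -/
def Action.Exclusive (a : Action) : Prop :=
  (∀ i, a.c i * a.d i = 0) ∧ a.x 0 * a.x 1 = 0

/-- Storage dynamics `s(t+1) = s(t) + α c(t) - d(t)`. -/
def nextStorage (α : ℝ) (s : Fin 2 → ℝ) (a : Action) : Fin 2 → ℝ :=
  fun i => s i + α * a.c i - a.d i

/-- The one-slot constraints, for storage levels `s` and net energies `e`:
nonnegativity, discharging at most what is stored, storage levels staying in `[0, Smax]`, and
energy neutralization `eᵢ + wᵢ - cᵢ + α dᵢ - xᵢⱼ + β xⱼᵢ ≥ 0` (`i.rev` is the other BS). -/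
structure Feasible (α β Smax : ℝ) (s e : Fin 2 → ℝ) (a : Action) : Prop where
  w_nonneg : ∀ i, 0 ≤ a.w i
  c_nonneg : ∀ i, 0 ≤ a.c i
  d_nonneg : ∀ i, 0 ≤ a.d i
  x_nonneg : ∀ i, 0 ≤ a.x i
  d_le : ∀ i, a.d i ≤ s i
  storage_nonneg : ∀ i, 0 ≤ nextStorage α s a i
  storage_le : ∀ i, nextStorage α s a i ≤ Smax
  neutral : ∀ i, 0 ≤ e i + a.w i - a.c i + α * a.d i - a.x i + β * a.x i.rev

/-- `a` is a solution of the two-step greedy program of one slot: it minimizes the total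
conventional energy among the feasible actions and, among the feasible actions that draw no more
conventional energy, it maximizes the sum of the resulting storage levels. -/
def IsGreedyAction (α β Smax : ℝ) (s e : Fin 2 → ℝ) (a : Action) : Prop :=
  Feasible α β Smax s e a ∧
  (∀ b, Feasible α β Smax s e b → a.grid ≤ b.grid) ∧
  (∀ b, Feasible α β Smax s e b → b.grid ≤ a.grid →
    nextStorage α s b 0 + nextStorage α s b 1 ≤ nextStorage α s a 0 + nextStorage α s a 1)

/-- A control policy: the action of slot `t` is a function of the history
`(E(1), …, E(t))` of net energies, listed by `Fin t`. -/
def Policy : Type := (t : ℕ) → (Fin t → Fin 2 → ℝ) → Action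

/-- All control variables are measurable functions of the history. -/
def Policy.Measurable (p : Policy) : Prop :=
  ∀ t, _root_.Measurable (fun h => (p t h).w) ∧ _root_.Measurable (fun h => (p t h).c) ∧
    _root_.Measurable (fun h => (p t h).d) ∧ _root_.Measurable (fun h => (p t h).x)

section Model

variable {Ω : Type*}

/-- The history `(E(1), …, E(t))`. -/
def history (E : ℕ → Ω → Fin 2 → ℝ) (t : ℕ) (ω : Ω) : Fin t → Fin 2 → ℝ :=
  fun j => E ((j : ℕ) + 1) ω

/-- The action that the policy takes in slot `t`. -/
def Policy.act (p : Policy) (E : ℕ → Ω → Fin 2 → ℝ) (t : ℕ) (ω : Ω) : Action :=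
  p t (history E t ω)

/-- The storage levels `s(t)`, `t ≥ k`, under policy `p` when `s(k) = s`
(the value is `s` for `t < k`, which is never used). -/
def storage (α : ℝ) (p : Policy) (E : ℕ → Ω → Fin 2 → ℝ) (k : ℕ) (s : Fin 2 → ℝ) (ω : Ω) :
    ℕ → Fin 2 → ℝ
  | 0 => s
  | t + 1 => if k ≤ t then nextStorage α (storage α p E k s ω t) (p.act E t ω) else s

variable [MeasurableSpace Ω]

/-- `p` is a (measurable, history-dependent) policy that, started in slot `k` with storage
levels `s`, almost surely satisfies all constraints in the slots `k, …, N`. -/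
def Admissible (α β Smax : ℝ) (N : ℕ) (μ : Measure Ω) (E : ℕ → Ω → Fin 2 → ℝ)
    (k : ℕ) (s : Fin 2 → ℝ) (p : Policy) : Prop :=
  p.Measurable ∧ ∀ t ∈ Finset.Icc k N, ∀ᵐ ω ∂μ,
    Feasible α β Smax (storage α p E k s ω t) (E t ω) (p.act E t ω)

/-- `p` is a greedy policy in the slots `k, …, N`, started in slot `k` with storage levels `s`:
almost surely each of its actions solves the greedy program for the current storage levels and
the current net energies. -/
def IsGreedy (α β Smax : ℝ) (N : ℕ) (μ : Measure Ω) (E : ℕ → Ω → Fin 2 → ℝ)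
    (k : ℕ) (s : Fin 2 → ℝ) (p : Policy) : Prop :=
  p.Measurable ∧ ∀ t ∈ Finset.Icc k N, ∀ᵐ ω ∂μ,
    IsGreedyAction α β Smax (storage α p E k s ω t) (E t ω) (p.act E t ω)

/-- The expected cost-to-go `𝔼 ∑_{t = k}^N (w₁(t) + w₂(t))`, as an element of `[0, ∞]`
(the summands are almost surely nonnegative for admissible policies). -/
noncomputable def costToGo (N : ℕ) (μ : Measure Ω) (E : ℕ → Ω → Fin 2 → ℝ)
    (k : ℕ) (p : Policy) : ENNReal :=
  ∫⁻ ω, ENNReal.ofReal (∑ t ∈ Finset.Icc k N, (p.act E t ω).grid) ∂μ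

/-- `p` is admissible and minimizes the expected cost-to-go from slot `k` and storage levels `s`
among all admissible policies. -/
def IsOptimal (α β Smax : ℝ) (N : ℕ) (μ : Measure Ω) (E : ℕ → Ω → Fin 2 → ℝ)
    (k : ℕ) (s : Fin 2 → ℝ) (p : Policy) : Prop :=
  Admissible α β Smax N μ E k s p ∧
  ∀ q, Admissible α β Smax N μ E k s q → costToGo N μ E k p ≤ costToGo N μ E k q

end Model

end EnergyCoop

/-!
Linear programming duality, along sample paths. Let station `i` be the one that never has a deficit.
Future slots then value stored energy at prices in the convex hull of `0`, `α (β, 1)` and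
`α (β, β²)`, station `i` listed first. Compare a greedy policy with a competitor through the
invariant that, at all of these prices, the stored energy of the competitor is worth at most that of
the greedy policy plus the conventional energy that the greedy policy has saved so far. To carry it
through a slot, weak duality bounds what the competitor can achieve, and an explicit greedy action
attains this bound: it has dual prices, again in the convex hull, that satisfy complementary
slackness. Every other greedy action has the same cost and the same total storage, which forces its
storage levels to have the same value at all the prices. At the price `0` the invariant says that
the greedy policy has drawn no more conventional energy than its competitor.
-/

namespace EnergyCoop

open scoped Matrix

theorem forall_iff_and_rev (i : Fin 2) {P : Fin 2 → Prop} : (∀ k, P k) ↔ P i ∧ P i.rev := by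
  fin_cases i
  · exact Fin.forall_fin_two
  · exact Fin.forall_fin_two.trans and_comm

theorem add_eq_add_rev (i : Fin 2) (f : Fin 2 → ℝ) : f 0 + f 1 = f i + f i.rev := by
  fin_cases i
  · rfl
  · exact add_comm _ _

theorem dotProduct_eq_add_rev (i : Fin 2) (u v : Fin 2 → ℝ) :
    u ⬝ᵥ v = u i * v i + u i.rev * v i.rev :=
  (Fin.sum_univ_two _).trans (add_eq_add_rev i fun k => u k * v k)

theorem mul_min_div_of_nonneg {a x y : ℝ} (ha : 0 ≤ a) (hy : 0 ≤ y) :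
    a * min x (y / a) = min (a * x) y := by
  rcases ha.eq_or_lt with rfl | ha
  · simp [hy]
  · rw [mul_min_of_nonneg _ _ ha.le, mul_div_cancel₀ _ ha.ne']

/-- The vector with entry `x` at station `i` and `y` at the other station. -/
def pair (i : Fin 2) (x y : ℝ) : Fin 2 → ℝ := Function.update (fun _ => y) i x

@[simp] theorem pair_self (i : Fin 2) (x y : ℝ) : pair i x y i = x := by simp [pair]

@[simp] theorem pair_rev (i : Fin 2) (x y : ℝ) : pair i x y i.rev = y := by
  fin_cases i <;> simp [pair]

/-! ### Shadow prices and dual certificates -/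

/-- Prices `ν` of stored energy and `ρ` of available energy, at the two stations, at which no
control of a slot is profitable when conventional energy costs `1` per unit: the constraints of the
linear program dual to that of one slot. -/
structure IsPriceSystem (α β : ℝ) (ν ρ : Fin 2 → ℝ) : Prop where
  nonneg : ∀ k, 0 ≤ ρ k
  grid : ∀ k, ρ k ≤ 1
  charge : ∀ k, α * ν k ≤ ρ k
  discharge : ∀ k, α * ρ k ≤ ν k
  transfer : ∀ k, β * ρ k.rev ≤ ρ k

section Prices

variable {α β S D : ℝ} {s e ν ρ : Fin 2 → ℝ} {K : Set (Fin 2 → ℝ)}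

theorem IsPriceSystem.smul {θ : ℝ} (h : IsPriceSystem α β ν ρ) (h0 : 0 ≤ θ) (h1 : θ ≤ 1) :
    IsPriceSystem α β (θ • ν) (θ • ρ) where
  nonneg k := mul_nonneg h0 (h.nonneg k)
  grid k := mul_le_one₀ h1 (h.nonneg k) (h.grid k)
  charge k := by
    simpa [mul_left_comm] using mul_le_mul_of_nonneg_left (h.charge k) h0
  discharge k := by
    simpa [mul_left_comm] using mul_le_mul_of_nonneg_left (h.discharge k) h0
  transfer k := by
    simpa [mul_left_comm] using mul_le_mul_of_nonneg_left (h.transfer k) h0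

theorem isPriceSystem_zero : IsPriceSystem α β 0 0 := by
  constructor <;> simp

/-- Weak duality for the linear program of one slot. -/
theorem IsPriceSystem.dotProduct_nextStorage_le {a : Action} (h : IsPriceSystem α β ν ρ)
    (ha : Feasible α β S s e a) :
    ν ⬝ᵥ nextStorage α s a ≤ ν ⬝ᵥ s + ρ ⬝ᵥ e + a.grid := by
  have slack (k : Fin 2) :
      ν k * (α * a.c k - a.d k) + ρ k * a.x k - β * (ρ k * a.x k.rev) ≤ ρ k * e k + a.w k := by
    linarith [mul_nonneg (h.nonneg k) (ha.neutral k),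
      mul_nonneg (sub_nonneg.2 (h.grid k)) (ha.w_nonneg k),
      mul_nonneg (sub_nonneg.2 (h.charge k)) (ha.c_nonneg k),
      mul_nonneg (sub_nonneg.2 (h.discharge k)) (ha.d_nonneg k)]
  have transfer (k : Fin 2) : β * (ρ k.rev * a.x k) ≤ ρ k * a.x k := by
    linarith [mul_le_mul_of_nonneg_right (h.transfer k) (ha.x_nonneg k)]
  have := transfer 0
  have := transfer 1
  have := slack 0
  have := slack 1
  simp only [dotProduct_eq_add_rev 0, Action.grid, nextStorage] at *
  simp only [show Fin.rev (0 : Fin 2) = 1 from rfl, show Fin.rev (1 : Fin 2) = 0 from rfl] at *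
  linarith

/-- Storage levels `a`, reached with costs lower by `D`, are at least as good as storage levels `b`
at all prices in `K`. -/
def Dominates (K : Set (Fin 2 → ℝ)) (D : ℝ) (a b : Fin 2 → ℝ) : Prop :=
  ∀ ν ∈ K, ν ⬝ᵥ b ≤ ν ⬝ᵥ a + D

theorem Dominates.refl (K : Set (Fin 2 → ℝ)) (a : Fin 2 → ℝ) : Dominates K 0 a a :=
  fun _ _ => (add_zero _).ge

theorem Dominates.toConvexHull {a b : Fin 2 → ℝ} (h : Dominates K D a b) :
    Dominates (convexHull ℝ K) D a b := by
  have hconvex : Convex ℝ {ν : Fin 2 → ℝ | ν ⬝ᵥ (b - a) ≤ D} :=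
    convex_halfSpace_le ⟨fun ν ν' => add_dotProduct ν ν' _, fun θ ν => smul_dotProduct θ ν _⟩ D
  have hsub (ν : Fin 2 → ℝ) : ν ⬝ᵥ (b - a) ≤ D ↔ ν ⬝ᵥ b ≤ ν ⬝ᵥ a + D := by
    rw [dotProduct_sub, sub_le_iff_le_add']
  exact fun ν hν => (hsub ν).1 (convexHull_min (fun ν hν => (hsub ν).2 (h ν hν)) hconvex hν)

/-- The action `f`, taken at storage levels `s` and net energies `e`, has a dual certificate of
optimality when the storage levels it leaves are valued at the prices `ν'`: some prices are tight on
`f`, and `ν'` differs from them only where the storage levels are at the bound that this favors. -/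
def IsCertified (α β S : ℝ) (K : Set (Fin 2 → ℝ)) (s e : Fin 2 → ℝ) (f : Action)
    (ν' : Fin 2 → ℝ) : Prop :=
  ∃ ν ∈ convexHull ℝ K, ∃ ρ, IsPriceSystem α β ν ρ ∧
    ν ⬝ᵥ s + ρ ⬝ᵥ e + f.grid ≤ ν ⬝ᵥ nextStorage α s f ∧
    ∀ k, IsMaxOn (fun z => (ν' k - ν k) * z) (Set.Icc 0 S) (nextStorage α s f k)

theorem Dominates.step {a b : Fin 2 → ℝ} {f g : Action} (hab : Dominates K D a b)
    (hf : ∀ ν' ∈ K, IsCertified α β S K a e f ν')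
    (hg : Feasible α β S b e g) :
    Dominates K (D + g.grid - f.grid) (nextStorage α a f) (nextStorage α b g) := by
  intro ν' hν'
  obtain ⟨ν, hν, ρ, hprice, htight, hmax⟩ := hf ν' hν'
  have hslack : (ν' - ν) ⬝ᵥ nextStorage α b g ≤ (ν' - ν) ⬝ᵥ nextStorage α a f :=
    Finset.sum_le_sum fun k _ => hmax k ⟨hg.storage_nonneg k, hg.storage_le k⟩
  rw [sub_dotProduct, sub_dotProduct] at hslack
  linarith [hprice.dotProduct_nextStorage_le hg, hab.toConvexHull ν hν]

end Prices

/-! ### Routing energy between the stations -/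

/-- The energy that station `k` lacks, before any transfer, to charge `c k` when it draws `w k` from
the grid and discharges `d k`. -/
def shortfall (α : ℝ) (e w c d : Fin 2 → ℝ) (k : Fin 2) : ℝ := c k - w k - α * d k - e k

/-- The action with given `w`, `c`, `d` in which each station receives exactly its shortfall. -/
noncomputable def dispatch (α β : ℝ) (e w c d : Fin 2 → ℝ) : Action where
  w := w
  c := c
  d := d
  x k := (shortfall α e w c d k.rev)⁺ / β

section Dispatch

variable {α β S : ℝ} {s e w c d : Fin 2 → ℝ}

theorem dispatch_feasible (hα : 0 ≤ α) (hβ : 0 ≤ β) (hw : 0 ≤ w) (hc : 0 ≤ c) (hd : 0 ≤ d)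
    (hds : d ≤ s) (hS : nextStorage α s (dispatch α β e w c d) ≤ fun _ => S)
    (hx : ∀ k, (shortfall α e w c d k.rev)⁺ ≤ β * (shortfall α e w c d k)⁻) :
    Feasible α β S s e (dispatch α β e w c d) where
  w_nonneg := hw
  c_nonneg := hc
  d_nonneg := hd
  x_nonneg _ := div_nonneg (posPart_nonneg _) hβ
  d_le := hds
  storage_nonneg k := by
    have := mul_nonneg hα (hc k)
    have := hds k
    simp only [nextStorage, dispatch]
    linarith
  storage_le := hS
  neutral k := by
    have hsend : (shortfall α e w c d k.rev)⁺ / β ≤ (shortfall α e w c d k)⁻ :=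
      div_le_of_le_mul₀ hβ (negPart_nonneg _) ((hx k).trans_eq (mul_comm _ _))
    have hreceive : β * ((shortfall α e w c d k)⁺ / β) = (shortfall α e w c d k)⁺ := by
      refine mul_div_cancel_of_imp' fun h => le_antisymm ?_ (posPart_nonneg _)
      simpa [h] using hx k.rev
    have hbalance : (shortfall α e w c d k)⁺ - (shortfall α e w c d k)⁻ =
        c k - w k - α * d k - e k := posPart_sub_negPart _
    simp only [dispatch, Fin.rev_rev]
    linarith

theorem dispatch_exclusive (hcd : ∀ k, c k * d k = 0)
    (hx : ∀ k, (shortfall α e w c d k.rev)⁺ ≤ β * (shortfall α e w c d k)⁻) :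
    (dispatch α β e w c d).Exclusive := by
  refine ⟨hcd, ?_⟩
  rcases le_total (shortfall α e w c d 0) 0 with h | h
  · exact mul_eq_zero_of_right _ (by simp [dispatch, h])
  · have h1 : (shortfall α e w c d 1)⁺ = 0 :=
      le_antisymm (by simpa [h] using hx 0) (posPart_nonneg _)
    exact mul_eq_zero_of_left (by simp [dispatch, h1]) _

end Dispatch

/-! ### A greedy action -/

/-- Energy at station `i` is worth what it yields at the other station when it is sent there. -/
def sendPrices (β : ℝ) (i : Fin 2) : Fin 2 → ℝ := pair i β 1

/-- Energy at the other station is worth what it yields at station `i`, at the price `β`, when it is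
sent there. -/
def fetchPrices (β : ℝ) (i : Fin 2) : Fin 2 → ℝ := pair i β (β ^ 2)

/-- The extreme values of stored energy when station `i` has no deficit, so that only a deficit of
the other station can call for it. The factor `α` is the loss in discharging. -/
def shadowPrices (α β : ℝ) (i : Fin 2) : Set (Fin 2 → ℝ) :=
  (α • ·) '' {0, sendPrices β i, fetchPrices β i}

section ShadowPrices

variable {α β : ℝ} {i : Fin 2}

@[simp] theorem sendPrices_self : sendPrices β i i = β := pair_self ..

@[simp] theorem sendPrices_rev : sendPrices β i i.rev = 1 := pair_rev ..

@[simp] theorem fetchPrices_self : fetchPrices β i i = β := pair_self ..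

@[simp] theorem fetchPrices_rev : fetchPrices β i i.rev = β ^ 2 := pair_rev ..

theorem sendPrices_dotProduct (v : Fin 2 → ℝ) :
    sendPrices β i ⬝ᵥ v = β * v i + v i.rev := by
  rw [dotProduct_eq_add_rev i, sendPrices_self, sendPrices_rev, one_mul]

theorem fetchPrices_dotProduct (v : Fin 2 → ℝ) :
    fetchPrices β i ⬝ᵥ v = β * v i + β ^ 2 * v i.rev := by
  rw [dotProduct_eq_add_rev i, fetchPrices_self, fetchPrices_rev]

theorem isPriceSystem_smul_smul {η : Fin 2 → ℝ} {κ : ℝ} (hα : 0 ≤ α)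
    (hακ : α ^ 2 ≤ κ) (hκ : κ ≤ 1) (h0 : ∀ k, 0 ≤ η k) (h1 : ∀ k, η k ≤ 1)
    (htransfer : ∀ k, β * η k.rev ≤ η k) : IsPriceSystem α β (α • η) (κ • η) := by
  have hκ0 : 0 ≤ κ := (sq_nonneg α).trans hακ
  refine ⟨fun k => ?_, fun k => ?_, fun k => ?_, fun k => ?_, fun k => ?_⟩ <;>
    simp only [Pi.smul_apply, smul_eq_mul]
  · exact mul_nonneg hκ0 (h0 k)
  · exact mul_le_one₀ hκ (h0 k) (h1 k)
  · linarith [mul_le_mul_of_nonneg_right hακ (h0 k)]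
  · linarith [mul_le_mul_of_nonneg_left hκ (mul_nonneg hα (h0 k))]
  · linarith [mul_le_mul_of_nonneg_left (htransfer k) hκ0]

theorem isPriceSystem_sendPrices {κ : ℝ} (hα : 0 ≤ α) (hαβ : α ≤ β) (hβ : β ≤ 1) (i : Fin 2)
    (hακ : α ^ 2 ≤ κ) (hκ : κ ≤ 1) :
    IsPriceSystem α β (α • sendPrices β i) (κ • sendPrices β i) := by
  refine isPriceSystem_smul_smul hα hακ hκ ?_ ?_ ?_ <;>
    simp only [forall_iff_and_rev i, sendPrices_self, sendPrices_rev, Fin.rev_rev] <;>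
    constructor <;> nlinarith

theorem isPriceSystem_fetchPrices (hα : 0 ≤ α) (hαβ : α ≤ β) (hβ : β ≤ 1) (i : Fin 2) :
    IsPriceSystem α β (α • fetchPrices β i) (α ^ 2 • fetchPrices β i) := by
  have hβ0 : 0 ≤ β := hα.trans hαβ
  have hβ2 : β ^ 2 ≤ 1 := pow_le_one₀ hβ0 hβ
  refine isPriceSystem_smul_smul hα le_rfl (pow_le_one₀ hα (hαβ.trans hβ)) ?_ ?_ ?_
    <;> simp only [forall_iff_and_rev i, fetchPrices_self, fetchPrices_rev, Fin.rev_rev] <;>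
    constructor <;> nlinarith

theorem isPriceSystem_fetchPrices_sendPrices {κ : ℝ} (hα : 0 ≤ α) (hαβ : α ≤ β) (hβ : β ≤ 1)
    (i : Fin 2) (hακ : α ^ 2 ≤ κ) (hκβ : κ ≤ β ^ 2) :
    IsPriceSystem α β (α • fetchPrices β i) (κ • sendPrices β i) := by
  have hβ0 : 0 ≤ β := hα.trans hαβ
  have hβ2 : β ^ 2 ≤ 1 := pow_le_one₀ hβ0 hβ
  have h := isPriceSystem_sendPrices hα hαβ hβ i hακ (hκβ.trans hβ2)
  refine ⟨h.nonneg, h.grid, ?_, ?_, h.transfer⟩ <;>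
    simp only [forall_iff_and_rev i, Pi.smul_apply, smul_eq_mul, sendPrices_self,
      sendPrices_rev, fetchPrices_self, fetchPrices_rev]
  · constructor
    · linarith [mul_le_mul_of_nonneg_right hακ hβ0]
    · nlinarith
  · constructor
    · linarith [mul_le_mul_of_nonneg_left (hκβ.trans hβ2) (mul_nonneg hα hβ0)]
    · linarith [mul_le_mul_of_nonneg_left hκβ hα]

end ShadowPrices

section IsMaxOn

variable {m S z : ℝ}

theorem isMaxOn_mul_of_eq_top (hm : 0 ≤ m) (h : m * z = m * S) :
    IsMaxOn (fun y => m * y) (Set.Icc 0 S) z :=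
  fun _ hy => (mul_le_mul_of_nonneg_left hy.2 hm).trans_eq h.symm

theorem isMaxOn_mul_of_eq_bot (hm : m ≤ 0) (h : m * z = 0) :
    IsMaxOn (fun y => m * y) (Set.Icc 0 S) z :=
  fun _ hy => (mul_nonpos_of_nonpos_of_nonneg hm hy.1).trans_eq h.symm

end IsMaxOn

/-- The energy that can be charged before the storage is full. For `α = 0` it is the junk value `0`,
the right choice since charging is useless. -/
noncomputable def room (α S : ℝ) (s : Fin 2 → ℝ) (k : Fin 2) : ℝ := (S - s k) / α

section Room

variable {α S : ℝ} {s : Fin 2 → ℝ}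

theorem room_nonneg (hα : 0 ≤ α) (hs : ∀ k, s k ≤ S) (k : Fin 2) : 0 ≤ room α S s k :=
  div_nonneg (sub_nonneg.2 (hs k)) hα

theorem mul_room_le {k : Fin 2} (hs : s k ≤ S) : α * room α S s k ≤ S - s k := by
  rcases eq_or_ne α 0 with rfl | hα
  · simpa using hs
  · exact (mul_div_cancel₀ _ hα).le

theorem mul_add_mul_room (k : Fin 2) : α * (s k + α * room α S s k) = α * S := by
  rcases eq_or_ne α 0 with rfl | hα
  · simp
  · rw [room, mul_div_cancel₀ _ hα, add_sub_cancel]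

end Room

/-- The energy charged at station `k` when each station charges its own net energy `e` first, up to
its limit `r`, and the excess is sent to the other station. -/
noncomputable def charge (β : ℝ) (e r : Fin 2 → ℝ) (k : Fin 2) : ℝ :=
  min (r k) (e k + β * (e k.rev - r k.rev)⁺)

/-- The net energies after station `i` has covered the deficit, if any, of the other station. -/
noncomputable def settle (β : ℝ) (i : Fin 2) (e : Fin 2 → ℝ) : Fin 2 → ℝ :=
  pair i (e i - (e i.rev)⁻ / β) (e i.rev)⁺

/-- The greedy action when station `i` can cover the deficit of the other station. -/
noncomputable def surplusAction (α β S : ℝ) (i : Fin 2) (s e : Fin 2 → ℝ) : Action :=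
  dispatch α β e 0 (charge β (settle β i e) (room α S s)) 0

section Charge

variable {β : ℝ} {e r : Fin 2 → ℝ} {k : Fin 2}

theorem charge_nonneg (hβ : 0 ≤ β) (he : ∀ k, 0 ≤ e k) (hr : ∀ k, 0 ≤ r k) : 0 ≤ charge β e r :=
  fun k => le_min (hr k) (add_nonneg (he k) (mul_nonneg hβ (posPart_nonneg _)))

theorem charge_le : charge β e r k ≤ r k := min_le_left _ _

theorem charge_sub_le (hβ : 0 ≤ β) : charge β e r k.rev - e k.rev ≤ β * (charge β e r k - e k)⁻ :=
  calc charge β e r k.rev - e k.rev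
    _ ≤ β * (e k - r k)⁺ := by
      rw [sub_le_iff_le_add', charge, Fin.rev_rev]
      exact min_le_right _ _
    _ ≤ β * (e k - charge β e r k)⁺ :=
      mul_le_mul_of_nonneg_left (posPart_mono (sub_le_sub_left charge_le _)) hβ
    _ = β * (charge β e r k - e k)⁻ := by rw [← posPart_neg, neg_sub]

theorem charge_eq_or (hβ : 0 ≤ β) (k : Fin 2) :
    charge β e r k = r k ∨ charge β e r k + β * charge β e r k.rev = e k + β * e k.rev := by
  refine or_iff_not_imp_left.2 fun hne => ?_
  have hlt : e k + β * (e k.rev - r k.rev)⁺ < r k := by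
    by_contra! h
    exact hne (min_eq_left h)
  have hle : e k ≤ r k := by
    linarith [mul_nonneg hβ (posPart_nonneg (e k.rev - r k.rev))]
  have hk : charge β e r k = e k + β * (e k.rev - r k.rev)⁺ := min_eq_right hlt.le
  have hrev : charge β e r k.rev = min (r k.rev) (e k.rev) := by
    simp [charge, hle]
  rw [hk, hrev]
  rcases le_total (e k.rev) (r k.rev) with h | h
  · rw [min_eq_right h, posPart_of_nonpos (sub_nonpos.2 h), mul_zero, add_zero]
  · rw [min_eq_left h, posPart_of_nonneg (sub_nonneg.2 h)]
    ring

theorem charge_rev_eq_or_sendPrices (hβ : 0 ≤ β) (i : Fin 2) :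
    charge β e r i.rev = r i.rev ∨ sendPrices β i ⬝ᵥ charge β e r = sendPrices β i ⬝ᵥ e := by
  refine (charge_eq_or hβ i.rev).imp_right fun h => ?_
  rw [Fin.rev_rev] at h
  rw [sendPrices_dotProduct, sendPrices_dotProduct]
  linear_combination h

theorem charge_eq_or_fetchPrices (hβ : 0 ≤ β) (i : Fin 2) :
    charge β e r i = r i ∨
      fetchPrices β i ⬝ᵥ charge β e r = fetchPrices β i ⬝ᵥ e := by
  refine (charge_eq_or hβ i).imp_right fun h => ?_
  rw [fetchPrices_dotProduct, fetchPrices_dotProduct]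
  linear_combination β * h

end Charge

section Surplus

variable {α β S : ℝ} {i : Fin 2} {s e : Fin 2 → ℝ}

theorem mul_negPart_div_of_le (h : (e i.rev)⁻ ≤ β * e i) :
    β * ((e i.rev)⁻ / β) = (e i.rev)⁻ :=
  mul_div_cancel_of_imp' fun h0 => le_antisymm (by simpa [h0] using h) (negPart_nonneg _)

theorem settle_nonneg (hβ : 0 ≤ β) (he : 0 ≤ e i) (h : (e i.rev)⁻ ≤ β * e i) (k : Fin 2) :
    0 ≤ settle β i e k := by
  revert k
  rw [forall_iff_and_rev i, settle, pair_self, pair_rev]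
  exact ⟨sub_nonneg.2 (div_le_of_le_mul₀ hβ he (h.trans_eq (mul_comm _ _))), posPart_nonneg _⟩

theorem charge_settle_transfer (hβ : 0 ≤ β) (h : (e i.rev)⁻ ≤ β * e i)
    {r : Fin 2 → ℝ} (hr : ∀ k, 0 ≤ r k) (k : Fin 2) :
    (charge β (settle β i e) r k.rev - e k.rev)⁺ ≤
      β * (charge β (settle β i e) r k - e k)⁻ := by
  have hsub (k) := charge_sub_le (e := settle β i e) (r := r) (k := k) hβ
  refine sup_le ?_ (mul_nonneg hβ (negPart_nonneg _))
  rcases le_total 0 (e i.rev) with hj | hj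
  · have hsettle : settle β i e = e := by
      refine funext <| (forall_iff_and_rev i).2 ?_
      simp [settle, hj]
    simpa only [hsettle] using hsub k
  · have hi : settle β i e i = e i - (e i.rev)⁻ / β := pair_self ..
    have hrev : settle β i e i.rev = 0 := by simp [settle, hj]
    have hcover := mul_negPart_div_of_le h
    rw [negPart_of_nonpos hj] at hcover hi
    have hci : charge β (settle β i e) r i ≤ settle β i e i := by
      simp [charge, hrev, hr]
    have hsub_i := hsub i
    rw [hrev, sub_zero, negPart_of_nonpos (sub_nonpos.2 hci), hi] at hsub_i
    have hdiv : 0 ≤ -e i.rev / β := div_nonneg (neg_nonneg.2 hj) hβ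
    revert k
    rw [forall_iff_and_rev i, Fin.rev_rev]
    constructor
    · rw [negPart_of_nonpos (by linarith)]
      linarith
    · linarith [mul_nonneg hβ (negPart_nonneg (charge β (settle β i e) r i.rev - e i.rev))]

theorem surplusAction_transfer (hα : 0 ≤ α) (hβ : 0 ≤ β) (hs : ∀ k, s k ≤ S)
    (h : (e i.rev)⁻ ≤ β * e i) (k : Fin 2) :
    (shortfall α e 0 (charge β (settle β i e) (room α S s)) 0 k.rev)⁺ ≤
      β * (shortfall α e 0 (charge β (settle β i e) (room α S s)) 0 k)⁻ := by
  simpa [shortfall] using charge_settle_transfer hβ h (room_nonneg hα hs) k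

theorem surplusAction_feasible (hα : 0 ≤ α) (hβ : 0 ≤ β) (hs : ∀ k, 0 ≤ s k ∧ s k ≤ S)
    (he : 0 ≤ e i) (h : (e i.rev)⁻ ≤ β * e i) :
    Feasible α β S s e (surplusAction α β S i s e) := by
  refine dispatch_feasible hα hβ le_rfl (charge_nonneg hβ (settle_nonneg hβ he h)
    (room_nonneg hα fun k => (hs k).2)) le_rfl
    (fun k => (hs k).1) (fun k => ?_) (surplusAction_transfer hα hβ (fun k => (hs k).2) h)
  have hcharge : α * charge β (settle β i e) (room α S s) k ≤ S - s k :=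
    (mul_le_mul_of_nonneg_left charge_le hα).trans (mul_room_le (hs k).2)
  simp only [nextStorage, dispatch, Pi.zero_apply, sub_zero]
  linarith

end Surplus

section SurplusCertificate

variable {α β S : ℝ} {i : Fin 2} {s e η ρ : Fin 2 → ℝ}

theorem surplusAction_exclusive (hα : 0 ≤ α) (hβ : 0 ≤ β) (hs : ∀ k, s k ≤ S)
    (h : (e i.rev)⁻ ≤ β * e i) : (surplusAction α β S i s e).Exclusive :=
  dispatch_exclusive (fun _ => mul_zero _) (surplusAction_transfer hα hβ hs h)

theorem surplusAction_grid : (surplusAction α β S i s e).grid = 0 := add_zero 0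

theorem nextStorage_surplusAction (k : Fin 2) :
    nextStorage α s (surplusAction α β S i s e) k =
      s k + α * charge β (settle β i e) (room α S s) k := sub_zero _

theorem mul_nextStorage_surplusAction_of_charge_eq_room {k : Fin 2}
    (h : charge β (settle β i e) (room α S s) k = room α S s k) :
    α * nextStorage α s (surplusAction α β S i s e) k = α * S := by
  rw [nextStorage_surplusAction, h, mul_add_mul_room]

theorem smul_dotProduct_nextStorage_surplusAction
    (hη : η ⬝ᵥ charge β (settle β i e) (room α S s) = η ⬝ᵥ settle β i e)
    (hρ : ρ ⬝ᵥ e = α ^ 2 * (η ⬝ᵥ settle β i e)) :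
    (α • η) ⬝ᵥ nextStorage α s (surplusAction α β S i s e) = (α • η) ⬝ᵥ s + ρ ⬝ᵥ e := by
  have hnext : nextStorage α s (surplusAction α β S i s e) =
      s + α • charge β (settle β i e) (room α S s) := funext nextStorage_surplusAction
  rw [hnext, dotProduct_add, smul_dotProduct, smul_dotProduct, dotProduct_smul, hη, hρ]
  simp only [smul_eq_mul]
  ring

theorem sendPrices_dotProduct_settle (h : (e i.rev)⁻ ≤ β * e i) :
    sendPrices β i ⬝ᵥ settle β i e = sendPrices β i ⬝ᵥ e := by
  rw [sendPrices_dotProduct, sendPrices_dotProduct, settle, pair_self, pair_rev]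
  linarith [mul_negPart_div_of_le h, posPart_sub_negPart (e i.rev)]

theorem exists_isPriceSystem_fetchPrices (hα : 0 ≤ α) (hαβ : α ≤ β) (hβ : β ≤ 1)
    (h : (e i.rev)⁻ ≤ β * e i) :
    ∃ ρ, IsPriceSystem α β (α • fetchPrices β i) ρ ∧
      ρ ⬝ᵥ e = α ^ 2 * (fetchPrices β i ⬝ᵥ settle β i e) := by
  rcases le_total 0 (e i.rev) with hj | hj
  · refine ⟨_, isPriceSystem_fetchPrices hα hαβ hβ i, ?_⟩
    rw [smul_dotProduct, fetchPrices_dotProduct, fetchPrices_dotProduct, settle, pair_self,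
      pair_rev]
    simp [hj]
  · have hsq : α ^ 2 ≤ β ^ 2 := pow_le_pow_left₀ hα hαβ 2
    refine ⟨_, isPriceSystem_fetchPrices_sendPrices hα hαβ hβ i le_rfl hsq, ?_⟩
    rw [smul_dotProduct, ← sendPrices_dotProduct_settle h, sendPrices_dotProduct,
      fetchPrices_dotProduct, settle, pair_self, pair_rev, posPart_of_nonpos hj, smul_eq_mul,
      mul_zero]

theorem isMaxOn_sub_self_mul (m : ℝ) (A : Set ℝ) (z : ℝ) :
    IsMaxOn (fun y => (m - m) * y) A z := by
  simpa using isMaxOn_const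

theorem isCertified_surplusAction {K : Set (Fin 2 → ℝ)} {η' : Fin 2 → ℝ} (hα : 0 ≤ α)
    (hη : α • η ∈ convexHull ℝ K) (hprice : IsPriceSystem α β (α • η) ρ)
    (hcharge : η ⬝ᵥ charge β (settle β i e) (room α S s) = η ⬝ᵥ settle β i e)
    (hρ : ρ ⬝ᵥ e = α ^ 2 * (η ⬝ᵥ settle β i e))
    (hslack : ∀ k, η k = η' k ∨
      η k ≤ η' k ∧ charge β (settle β i e) (room α S s) k = room α S s k) :
    IsCertified α β S K s e (surplusAction α β S i s e) (α • η') := by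
  refine ⟨_, hη, ρ, hprice, ?_, fun k => ?_⟩
  · rw [surplusAction_grid, add_zero, smul_dotProduct_nextStorage_surplusAction hcharge hρ]
  · simp only [Pi.smul_apply, smul_eq_mul]
    rcases hslack k with heq | ⟨hle, hfull⟩
    · exact heq ▸ isMaxOn_sub_self_mul _ _ _
    · refine isMaxOn_mul_of_eq_top (sub_nonneg.2 (mul_le_mul_of_nonneg_left hle hα)) ?_
      linear_combination
        (η' k - η k) * mul_nextStorage_surplusAction_of_charge_eq_room (i := i) (e := e) hfull

theorem smul_mem_convexHull_shadowPrices
    (hη : η ∈ ({0, sendPrices β i, fetchPrices β i} : Set _)) :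
    α • η ∈ convexHull ℝ (shadowPrices α β i) :=
  subset_convexHull _ _ (Set.mem_image_of_mem _ hη)

theorem isCertified_surplusAction_of_sendPrices {θ : ℝ} {η' : Fin 2 → ℝ} (hα : 0 ≤ α)
    (hαβ : α ≤ β) (hβ : β ≤ 1) (h : (e i.rev)⁻ ≤ β * e i) (hθ0 : 0 ≤ θ) (hθ1 : θ ≤ 1)
    (hcharge : sendPrices β i ⬝ᵥ charge β (settle β i e) (room α S s) =
      sendPrices β i ⬝ᵥ settle β i e)
    (hslack : ∀ k, (θ • sendPrices β i) k = η' k ∨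
      (θ • sendPrices β i) k ≤ η' k ∧ charge β (settle β i e) (room α S s) k = room α S s k) :
    IsCertified α β S (shadowPrices α β i) s e (surplusAction α β S i s e) (α • η') := by
  have hprice := isPriceSystem_sendPrices hα hαβ hβ i le_rfl (pow_le_one₀ hα (hαβ.trans hβ))
  refine isCertified_surplusAction (η := θ • sendPrices β i) hα ?_
    (smul_comm α θ (sendPrices β i) ▸ hprice.smul hθ0 hθ1) ?_ ?_ hslack
  · rw [smul_comm α θ (sendPrices β i)]
    exact (convex_convexHull ℝ _).smul_mem_of_zero_mem
      (smul_zero (A := Fin 2 → ℝ) α ▸ smul_mem_convexHull_shadowPrices (.inl rfl))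
      (smul_mem_convexHull_shadowPrices (.inr (.inl rfl))) ⟨hθ0, hθ1⟩
  · rw [smul_dotProduct, smul_dotProduct, hcharge]
  · rw [smul_dotProduct, smul_dotProduct, smul_dotProduct, sendPrices_dotProduct_settle h,
      smul_eq_mul, smul_eq_mul, smul_eq_mul, mul_left_comm]

theorem isCertified_surplusAction_of_mem (hα : 0 ≤ α) (hαβ : α ≤ β) (hβ : β ≤ 1)
    (h : (e i.rev)⁻ ≤ β * e i) :
    ∀ ν' ∈ shadowPrices α β i,
      IsCertified α β S (shadowPrices α β i) s e (surplusAction α β S i s e) ν' := by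
  have hβ0 : 0 ≤ β := hα.trans hαβ
  have hβ2 : β ^ 2 ≤ 1 := pow_le_one₀ hβ0 hβ
  obtain ⟨ρ, hprice, hρ⟩ := exists_isPriceSystem_fetchPrices hα hαβ hβ h
  have hzero {η'} (hslack) := isCertified_surplusAction (β := β) (S := S) (i := i) (s := s)
    (e := e) (η' := η') (ρ := 0) hα (smul_mem_convexHull_shadowPrices (β := β) (i := i) (.inl rfl))
    (by simpa using isPriceSystem_zero) (by simp) (by simp) hslack
  have hright {η'} (hcharge) (hslack) := isCertified_surplusAction (S := S) (s := s) (η' := η') hα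
    (smul_mem_convexHull_shadowPrices (.inr (.inr rfl))) hprice hcharge hρ hslack
  rintro _ ⟨_, rfl | rfl | rfl, rfl⟩
  · exact hzero fun _ => .inl rfl
  · rcases charge_rev_eq_or_sendPrices hβ0 i with hj | hc
    · rcases charge_eq_or_fetchPrices hβ0 i with hi | hc
      · exact hzero <| (forall_iff_and_rev i).2
          ⟨.inr ⟨by simpa using hβ0, hi⟩, .inr ⟨by simp, hj⟩⟩
      · exact hright hc <| (forall_iff_and_rev i).2 ⟨.inl (by simp), .inr ⟨by simpa using hβ2, hj⟩⟩
    · exact isCertified_surplusAction_of_sendPrices hα hαβ hβ h zero_le_one le_rfl hc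
        fun _ => .inl (by simp)
  · rcases charge_eq_or_fetchPrices hβ0 i with hi | hc
    · rcases charge_rev_eq_or_sendPrices hβ0 i with hj | hc
      · exact hzero <| (forall_iff_and_rev i).2
          ⟨.inr ⟨by simpa using hβ0, hi⟩, .inr ⟨by simpa using sq_nonneg β, hj⟩⟩
      · refine isCertified_surplusAction_of_sendPrices hα hαβ hβ h (sq_nonneg β) hβ2 hc <|
          (forall_iff_and_rev i).2 ⟨.inr ⟨?_, hi⟩, .inl (by simp)⟩
        simpa using mul_le_of_le_one_left hβ0 hβ2
    · exact hright hc fun _ => .inl rfl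

end SurplusCertificate

/-- What the other station lacks after station `i` has sent it all its net energy. -/
def deficit (β : ℝ) (i : Fin 2) (e : Fin 2 → ℝ) : ℝ := -e i.rev - β * e i

/-- The energy discharged to cover the deficit, from the storage of the station in deficit first. -/
noncomputable def relief (α β : ℝ) (i : Fin 2) (s e : Fin 2 → ℝ) : Fin 2 → ℝ :=
  pair i (min (s i) ((deficit β i e - α * min (s i.rev) (deficit β i e / α)) / (α * β)))
    (min (s i.rev) (deficit β i e / α))

/-- The greedy action when station `i` cannot cover the deficit of the other station. -/
noncomputable def deficitAction (α β : ℝ) (i : Fin 2) (s e : Fin 2 → ℝ) : Action :=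
  dispatch α β e (pair i 0 (deficit β i e - (α • sendPrices β i) ⬝ᵥ relief α β i s e)) 0
    (relief α β i s e)

section Deficit

variable {α β S : ℝ} {i : Fin 2} {s e : Fin 2 → ℝ}

theorem mul_relief_rev (hα : 0 ≤ α) (h : 0 ≤ deficit β i e) :
    α * relief α β i s e i.rev = min (α * s i.rev) (deficit β i e) := by
  rw [relief, pair_rev, mul_min_div_of_nonneg hα h]

theorem mul_relief (hα : 0 ≤ α) (hβ : 0 ≤ β) (h : 0 ≤ deficit β i e) :
    α * β * relief α β i s e i =
      min (α * β * s i) (deficit β i e - α * relief α β i s e i.rev) := by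
  have hrest : 0 ≤ deficit β i e - α * relief α β i s e i.rev := by
    rw [mul_relief_rev hα h, sub_nonneg]
    exact min_le_right _ _
  rw [← mul_min_div_of_nonneg (mul_nonneg hα hβ) hrest, relief, pair_self, pair_rev]

theorem relief_nonneg (hα : 0 ≤ α) (hβ : 0 ≤ β) (hs : 0 ≤ s) (h : 0 ≤ deficit β i e) :
    0 ≤ relief α β i s e := by
  have hrev : α * min (s i.rev) (deficit β i e / α) ≤ deficit β i e := by
    rw [mul_min_div_of_nonneg hα h]
    exact min_le_right _ _
  refine (forall_iff_and_rev i).2 ?_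
  rw [relief, pair_self, pair_rev]
  exact ⟨le_min (hs i) (div_nonneg (sub_nonneg.2 hrev) (mul_nonneg hα hβ)),
    le_min (hs _) (div_nonneg h hα)⟩

theorem relief_le : relief α β i s e ≤ s := by
  refine (forall_iff_and_rev i).2 ?_
  rw [relief, pair_self, pair_rev]
  exact ⟨min_le_left _ _, min_le_left _ _⟩

theorem smul_dotProduct_relief :
    (α • sendPrices β i) ⬝ᵥ relief α β i s e =
      α * β * relief α β i s e i + α * relief α β i s e i.rev := by
  rw [smul_dotProduct, sendPrices_dotProduct, smul_eq_mul]
  ring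

theorem smul_dotProduct_relief_le (hα : 0 ≤ α) (hβ : 0 ≤ β) (h : 0 ≤ deficit β i e) :
    (α • sendPrices β i) ⬝ᵥ relief α β i s e ≤ deficit β i e := by
  rw [smul_dotProduct_relief, mul_relief hα hβ h]
  exact le_sub_iff_add_le.1 (min_le_right _ _)

theorem relief_cases (hα : 0 ≤ α) (hβ : 0 ≤ β) (hs : 0 ≤ s) (h : 0 ≤ deficit β i e) :
    (α * relief α β i s e i.rev = deficit β i e ∧ α * β * relief α β i s e i = 0) ∨
    α * relief α β i s e i.rev = α * s i.rev ∧
      (α * β * relief α β i s e i = α * β * s i ∨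
        (α • sendPrices β i) ⬝ᵥ relief α β i s e = deficit β i e) := by
  rcases le_total (α * s i.rev) (deficit β i e) with hj | hj
  · refine .inr ⟨by rw [mul_relief_rev hα h, min_eq_left hj], ?_⟩
    rw [smul_dotProduct_relief, ← eq_sub_iff_add_eq, mul_relief hα hβ h]
    exact min_choice _ _
  · have hrev : α * relief α β i s e i.rev = deficit β i e := by
      rw [mul_relief_rev hα h, min_eq_right hj]
    refine .inl ⟨hrev, ?_⟩
    rw [mul_relief hα hβ h, hrev, sub_self,
      min_eq_right (mul_nonneg (mul_nonneg hα hβ) (hs i))]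

theorem deficitAction_grid :
    (deficitAction α β i s e).grid =
      deficit β i e - (α • sendPrices β i) ⬝ᵥ relief α β i s e := by
  refine (add_eq_add_rev i _).trans ?_
  simp [deficitAction, dispatch]

theorem nextStorage_deficitAction :
    nextStorage α s (deficitAction α β i s e) = s - relief α β i s e := by
  ext k
  simp [nextStorage, deficitAction, dispatch]

theorem deficitAction_transfer (hα : 0 ≤ α) (hβ : 0 ≤ β) (hs : 0 ≤ s) (he : 0 ≤ e i)
    (h : 0 ≤ deficit β i e) (k : Fin 2) :
    (shortfall α e (deficitAction α β i s e).w 0 (relief α β i s e) k.rev)⁺ ≤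
      β * (shortfall α e (deficitAction α β i s e).w 0 (relief α β i s e) k)⁻ := by
  set w := (deficitAction α β i s e).w
  have hw : w = pair i 0 (deficit β i e - (α • sendPrices β i) ⬝ᵥ relief α β i s e) := rfl
  have hi : shortfall α e w 0 (relief α β i s e) i ≤ 0 := by
    simp only [shortfall, hw, pair_self, Pi.zero_apply]
    linarith [mul_nonneg hα (relief_nonneg hα hβ hs h i)]
  have hrev : shortfall α e w 0 (relief α β i s e) i.rev =
      β * -shortfall α e w 0 (relief α β i s e) i := by
    simp only [shortfall, hw, pair_self, pair_rev, Pi.zero_apply, smul_dotProduct_relief, deficit]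
    ring
  revert k
  refine (forall_iff_and_rev i).2 ⟨?_, ?_⟩
  · rw [hrev, negPart_of_nonpos hi, posPart_of_nonneg (mul_nonneg hβ (neg_nonneg.2 hi))]
  · rw [Fin.rev_rev, posPart_of_nonpos hi]
    exact mul_nonneg hβ (negPart_nonneg _)

theorem deficitAction_feasible (hα : 0 ≤ α) (hβ : 0 ≤ β) (hs : ∀ k, 0 ≤ s k ∧ s k ≤ S)
    (he : 0 ≤ e i) (h : 0 ≤ deficit β i e) :
    Feasible α β S s e (deficitAction α β i s e) := by
  have hs0 : 0 ≤ s := fun k => (hs k).1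
  refine dispatch_feasible hα hβ ((forall_iff_and_rev i).2 ?_) le_rfl (relief_nonneg hα hβ hs0 h)
    relief_le (fun k => ?_) (deficitAction_transfer hα hβ hs0 he h)
  · rw [pair_self, pair_rev]
    exact ⟨le_rfl, sub_nonneg.2 (smul_dotProduct_relief_le hα hβ h)⟩
  · refine (congrFun nextStorage_deficitAction k).trans_le ?_
    exact (sub_le_self _ (relief_nonneg hα hβ hs0 h k)).trans (hs k).2

theorem deficitAction_exclusive (hα : 0 ≤ α) (hβ : 0 ≤ β) (hs : 0 ≤ s) (he : 0 ≤ e i)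
    (h : 0 ≤ deficit β i e) : (deficitAction α β i s e).Exclusive :=
  dispatch_exclusive (fun _ => zero_mul _) (deficitAction_transfer hα hβ hs he h)

theorem isCertified_deficitAction_of_sendPrices {ν' : Fin 2 → ℝ} (hα : 0 ≤ α)
    (hαβ : α ≤ β) (hβ : β ≤ 1)
    (hslack : ∀ k, IsMaxOn (fun z => (ν' k - (α • sendPrices β i) k) * z) (Set.Icc 0 S)
      ((s - relief α β i s e) k)) :
    IsCertified α β S (shadowPrices α β i) s e (deficitAction α β i s e) ν' := by
  have hα2 : α ^ 2 ≤ 1 := pow_le_one₀ hα (hαβ.trans hβ)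
  refine ⟨_, smul_mem_convexHull_shadowPrices (.inr (.inl rfl)), _,
    isPriceSystem_sendPrices hα hαβ hβ i hα2 le_rfl, ?_, nextStorage_deficitAction ▸ hslack⟩
  rw [nextStorage_deficitAction, dotProduct_sub, deficitAction_grid, one_smul,
    sendPrices_dotProduct e, deficit]
  linarith

theorem isCertified_deficitAction_fetchPrices (hα : 0 ≤ α) (hαβ : α ≤ β) (hβ : β ≤ 1)
    (hrev : α * relief α β i s e i.rev = deficit β i e)
    (hi : α * β * relief α β i s e i = 0) :
    IsCertified α β S (shadowPrices α β i) s e (deficitAction α β i s e)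
      (α • fetchPrices β i) := by
  have hsq : α ^ 2 ≤ β ^ 2 := pow_le_pow_left₀ hα hαβ 2
  refine ⟨_, smul_mem_convexHull_shadowPrices (.inr (.inr rfl)), _,
    isPriceSystem_fetchPrices_sendPrices hα hαβ hβ i hsq le_rfl, ?_,
    fun _ => isMaxOn_sub_self_mul _ _ _⟩
  rw [nextStorage_deficitAction, dotProduct_sub, deficitAction_grid, smul_dotProduct_relief, hrev,
    hi, smul_dotProduct (β ^ 2), sendPrices_dotProduct e, smul_dotProduct α _ (relief α β i s e),
    fetchPrices_dotProduct (relief α β i s e)]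
  simp only [smul_eq_mul]
  unfold deficit at hrev ⊢
  linear_combination hi + β ^ 2 * hrev

theorem isCertified_deficitAction_of_mem (hα : 0 ≤ α) (hαβ : α ≤ β) (hβ : β ≤ 1) (hs : 0 ≤ s)
    (h : 0 ≤ deficit β i e) :
    ∀ ν' ∈ shadowPrices α β i,
      IsCertified α β S (shadowPrices α β i) s e (deficitAction α β i s e) ν' := by
  have hβ0 : 0 ≤ β := hα.trans hαβ
  have hzero (hgrid : (α • sendPrices β i) ⬝ᵥ relief α β i s e = deficit β i e) :
      IsCertified α β S (shadowPrices α β i) s e (deficitAction α β i s e) (α • 0) := by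
    refine ⟨_, smul_mem_convexHull_shadowPrices (.inl rfl), 0, by simpa using isPriceSystem_zero,
      ?_, fun _ => isMaxOn_sub_self_mul _ _ _⟩
    simp [deficitAction_grid, hgrid]
  rintro _ ⟨_, rfl | rfl | rfl, rfl⟩
  · rcases relief_cases hα hβ0 hs h with ⟨hrev, hi⟩ | ⟨hrev, hi | hgrid⟩
    · exact hzero (by rw [smul_dotProduct_relief, hrev, hi, zero_add])
    · refine isCertified_deficitAction_of_sendPrices hα hαβ hβ <|
        (forall_iff_and_rev i).2 ⟨?_, ?_⟩
      · refine isMaxOn_mul_of_eq_bot (by simpa using mul_nonneg hα hβ0) ?_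
        simp only [Pi.smul_apply, Pi.sub_apply, Pi.zero_apply, smul_eq_mul, sendPrices_self]
        linear_combination hi
      · refine isMaxOn_mul_of_eq_bot (by simpa using hα) ?_
        simp only [Pi.smul_apply, Pi.sub_apply, Pi.zero_apply, smul_eq_mul, sendPrices_rev]
        linear_combination hrev
    · exact hzero hgrid
  · exact isCertified_deficitAction_of_sendPrices hα hαβ hβ fun _ => isMaxOn_sub_self_mul _ _ _
  · rcases relief_cases hα hβ0 hs h with ⟨hrev, hi⟩ | ⟨hrev, -⟩
    · exact isCertified_deficitAction_fetchPrices hα hαβ hβ hrev hi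
    · refine isCertified_deficitAction_of_sendPrices hα hαβ hβ <|
        (forall_iff_and_rev i).2 ⟨?_, ?_⟩
      · simpa using isMaxOn_const
      · refine isMaxOn_mul_of_eq_bot ?_ ?_ <;>
          simp only [Pi.smul_apply, Pi.sub_apply, smul_eq_mul, sendPrices_rev, fetchPrices_rev]
        · nlinarith [pow_le_one₀ (n := 2) hβ0 hβ]
        · linear_combination (1 - β ^ 2) * hrev

end Deficit

/-- A greedy action, when station `i` has no deficit. -/
noncomputable def greedyAction (α β S : ℝ) (i : Fin 2) (s e : Fin 2 → ℝ) : Action :=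
  if deficit β i e ≤ 0 then surplusAction α β S i s e else deficitAction α β i s e

section GreedyAction

variable {α β S D : ℝ} {i : Fin 2} {s e a b : Fin 2 → ℝ} {f g : Action}

theorem negPart_le_of_deficit_nonpos (hβ : 0 ≤ β) (he : 0 ≤ e i) (h : deficit β i e ≤ 0) :
    (e i.rev)⁻ ≤ β * e i :=
  sup_le (sub_nonpos.1 h) (mul_nonneg hβ he)

theorem greedyAction_feasible (hα : 0 ≤ α) (hβ : 0 ≤ β) (hs : ∀ k, 0 ≤ s k ∧ s k ≤ S)
    (he : 0 ≤ e i) : Feasible α β S s e (greedyAction α β S i s e) := by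
  rw [greedyAction]
  split_ifs with h
  · exact surplusAction_feasible hα hβ hs he (negPart_le_of_deficit_nonpos hβ he h)
  · exact deficitAction_feasible hα hβ hs he (le_of_not_ge h)

theorem greedyAction_exclusive (hα : 0 ≤ α) (hβ : 0 ≤ β) (hs : ∀ k, 0 ≤ s k ∧ s k ≤ S)
    (he : 0 ≤ e i) : (greedyAction α β S i s e).Exclusive := by
  rw [greedyAction]
  split_ifs with h
  · exact surplusAction_exclusive hα hβ (fun k => (hs k).2) (negPart_le_of_deficit_nonpos hβ he h)
  · exact deficitAction_exclusive hα hβ (fun k => (hs k).1) he (le_of_not_ge h)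

theorem isCertified_greedyAction (hα : 0 ≤ α) (hαβ : α ≤ β) (hβ : β ≤ 1) (hs : 0 ≤ s)
    (he : 0 ≤ e i) :
    ∀ ν ∈ shadowPrices α β i,
      IsCertified α β S (shadowPrices α β i) s e (greedyAction α β S i s e) ν := by
  rw [greedyAction]
  split_ifs with h
  · exact isCertified_surplusAction_of_mem hα hαβ hβ
      (negPart_le_of_deficit_nonpos (hα.trans hαβ) he h)
  · exact isCertified_deficitAction_of_mem hα hαβ hβ hs (le_of_not_ge h)

theorem dominates_shadowPrices_iff :
    Dominates (shadowPrices α β i) D a b ↔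
      0 ≤ D ∧ (α • sendPrices β i) ⬝ᵥ b ≤ (α • sendPrices β i) ⬝ᵥ a + D ∧
        (α • fetchPrices β i) ⬝ᵥ b ≤ (α • fetchPrices β i) ⬝ᵥ a + D := by
  simp only [Dominates, shadowPrices, Set.forall_mem_image, Set.mem_insert_iff,
    Set.mem_singleton_iff, forall_eq_or_imp, forall_eq, smul_zero, zero_dotProduct, zero_add]

theorem Dominates.nonneg (h : Dominates (shadowPrices α β i) D a b) : 0 ≤ D :=
  (dominates_shadowPrices_iff.1 h).1

theorem Dominates.trans {K : Set (Fin 2 → ℝ)} {c : Fin 2 → ℝ} {D' : ℝ} (h : Dominates K D a b)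
    (h' : Dominates K D' b c) : Dominates K (D + D') a c :=
  fun ν hν => by linarith [h ν hν, h' ν hν]

theorem mul_sendPrices_add_fetchPrices_dotProduct (v : Fin 2 → ℝ) :
    β * ((α • sendPrices β i) ⬝ᵥ v) + (α • fetchPrices β i) ⬝ᵥ v =
      α * β * (1 + β) * (v 0 + v 1) := by
  rw [smul_dotProduct, smul_dotProduct, sendPrices_dotProduct, fetchPrices_dotProduct,
    add_eq_add_rev i v, smul_eq_mul, smul_eq_mul]
  ring

theorem Dominates.add_le (hα : 0 < α) (hβ : 0 < β) (h : Dominates (shadowPrices α β i) D a b)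
    (hD : D ≤ 0) : b 0 + b 1 ≤ a 0 + a 1 := by
  obtain ⟨-, hleft, hright⟩ := dominates_shadowPrices_iff.1 h
  refine le_of_mul_le_mul_left ?_ (show 0 < α * β * (1 + β) by positivity)
  rw [← mul_sendPrices_add_fetchPrices_dotProduct (i := i),
    ← mul_sendPrices_add_fetchPrices_dotProduct (i := i)]
  exact add_le_add (mul_le_mul_of_nonneg_left (by linarith) hβ.le) (by linarith)

theorem Dominates.symm_of_add_le (hα : 0 ≤ α) (hαβ : α ≤ β)
    (h : Dominates (shadowPrices α β i) 0 a b) (hab : a 0 + a 1 ≤ b 0 + b 1) :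
    Dominates (shadowPrices α β i) 0 b a := by
  rcases hα.eq_or_lt with rfl | hα
  · simp [dominates_shadowPrices_iff]
  have hβ : 0 < β := hα.trans_le hαβ
  simp only [dominates_shadowPrices_iff, add_zero] at h ⊢
  obtain ⟨-, hleft, hright⟩ := h
  have hsum := mul_le_mul_of_nonneg_left hab (show 0 ≤ α * β * (1 + β) by positivity)
  rw [← mul_sendPrices_add_fetchPrices_dotProduct (i := i),
    ← mul_sendPrices_add_fetchPrices_dotProduct (i := i)] at hsum
  refine ⟨le_rfl, le_of_mul_le_mul_left ?_ hβ, ?_⟩ <;>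
    linarith [mul_le_mul_of_nonneg_left hleft hβ.le]

theorem nextStorage_greedyAction_zero (hs : 0 ≤ s) :
    nextStorage 0 s (greedyAction 0 β S i s e) = s := by
  rw [greedyAction]
  split_ifs
  · ext k
    rw [nextStorage_surplusAction, zero_mul, add_zero]
  · have hrelief : relief 0 β i s e = 0 := by
      refine funext <| (forall_iff_and_rev i).2 ?_
      simpa [relief] using And.intro (hs i) (hs i.rev)
    rw [nextStorage_deficitAction, hrelief, sub_zero]

theorem isGreedyAction_greedyAction (hα : 0 ≤ α) (hαβ : α ≤ β) (hβ : β ≤ 1)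
    (hs : ∀ k, 0 ≤ s k ∧ s k ≤ S) (he : 0 ≤ e i) :
    IsGreedyAction α β S s e (greedyAction α β S i s e) := by
  have hs0 : 0 ≤ s := fun k => (hs k).1
  have hdom {b} (hb : Feasible α β S s e b) :=
    (Dominates.refl _ s).step (isCertified_greedyAction hα hαβ hβ hs0 he) hb
  refine ⟨greedyAction_feasible hα (hα.trans hαβ) hs he, fun b hb => ?_, fun b hb hgrid => ?_⟩
  · linarith [(hdom hb).nonneg]
  · rcases hα.eq_or_lt with rfl | hα
    · rw [nextStorage_greedyAction_zero hs0]
      have hle (k) : nextStorage 0 s b k ≤ s k := by simpa [nextStorage] using hb.d_nonneg k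
      exact add_le_add (hle 0) (hle 1)
    · exact (hdom hb).add_le hα (hα.trans_le hαβ) (by linarith)

theorem Dominates.step_of_isGreedyAction (hα : 0 ≤ α) (hαβ : α ≤ β) (hβ : β ≤ 1)
    (ha : ∀ k, 0 ≤ a k ∧ a k ≤ S) (he : 0 ≤ e i) (hab : Dominates (shadowPrices α β i) D a b)
    (hf : IsGreedyAction α β S a e f) (hg : Feasible α β S b e g) :
    Dominates (shadowPrices α β i) (D + g.grid - f.grid) (nextStorage α a f)
      (nextStorage α b g) := by
  obtain ⟨hfeasible, hmin, hmax⟩ := hf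
  have hc := isGreedyAction_greedyAction hα hαβ hβ ha he
  have hcert := isCertified_greedyAction (S := S) hα hαβ hβ (fun k => (ha k).1) he
  have hgrid : f.grid = (greedyAction α β S i a e).grid :=
    le_antisymm (hmin _ hc.1) (hc.2.1 f hfeasible)
  have hdom := (Dominates.refl _ a).step hcert hfeasible
  rw [hgrid, zero_add, sub_self] at hdom
  have hsymm := hdom.symm_of_add_le hα hαβ (hmax _ hc.1 hgrid.ge)
  rw [hgrid]
  simpa only [zero_add] using hsymm.trans (hab.step hcert hg)

end GreedyAction

/-! ### Measurability of the greedy action -/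

/-- The `σ`-algebra for which an action is measurable when its components are. -/
instance : MeasurableSpace Action :=
  MeasurableSpace.comap (fun a => (a.w, a.c, a.d, a.x)) inferInstance

section Measurability

variable {X : Type*} [MeasurableSpace X] {e s w c d r : X → Fin 2 → ℝ} {α β S : ℝ} {i : Fin 2}

theorem measurable_action_iff {f : X → Action} :
    Measurable f ↔ Measurable (fun x => (f x).w) ∧ Measurable (fun x => (f x).c) ∧
      Measurable (fun x => (f x).d) ∧ Measurable (fun x => (f x).x) := by
  rw [measurable_comap_iff]
  exact ⟨fun h => ⟨h.fst, h.snd.fst, h.snd.snd.fst, h.snd.snd.snd⟩,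
    fun h => h.1.prodMk (h.2.1.prodMk (h.2.2.1.prodMk h.2.2.2))⟩

theorem measurable_nextStorage {f : X → Action} (hs : Measurable s) (hf : Measurable f) :
    Measurable fun x => nextStorage α (s x) (f x) := by
  obtain ⟨-, hc, hd, -⟩ := measurable_action_iff.1 hf
  exact (hs.add (hc.const_smul α)).sub hd

theorem measurable_pair {u v : X → ℝ} (hu : Measurable u) (hv : Measurable v) :
    Measurable fun x => pair i (u x) (v x) := by
  refine measurable_pi_iff.2 <| (forall_iff_and_rev i).2 ?_
  simpa using And.intro hu hv

theorem measurable_dispatch (he : Measurable e) (hw : Measurable w) (hc : Measurable c)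
    (hd : Measurable d) : Measurable fun x => dispatch α β (e x) (w x) (c x) (d x) := by
  refine measurable_action_iff.2 ⟨hw, hc, hd, ?_⟩
  simp only [dispatch, shortfall, posPart_def]
  fun_prop

theorem measurable_room (hs : Measurable s) : Measurable fun x => room α S (s x) := by
  unfold room
  fun_prop

theorem measurable_charge (he : Measurable e) (hr : Measurable r) :
    Measurable fun x => charge β (e x) (r x) := by
  unfold charge
  simp only [posPart_def]
  fun_prop

theorem measurable_settle (he : Measurable e) : Measurable fun x => settle β i (e x) := by
  refine measurable_pair ?_ ?_ <;> simp only [posPart_def, negPart_def] <;> fun_prop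

theorem measurable_deficit (he : Measurable e) : Measurable fun x => deficit β i (e x) := by
  unfold deficit
  fun_prop

theorem measurable_relief (hs : Measurable s) (he : Measurable e) :
    Measurable fun x => relief α β i (s x) (e x) := by
  have := measurable_deficit (β := β) (i := i) he
  refine measurable_pair ?_ ?_ <;> fun_prop

theorem measurable_greedyAction (hs : Measurable s) (he : Measurable e) :
    Measurable fun x => greedyAction α β S i (s x) (e x) := by
  have hdeficit := measurable_deficit (β := β) (i := i) he
  have hrelief := measurable_relief (α := α) (β := β) (i := i) hs he
  refine Measurable.ite (hdeficit measurableSet_Iic) ?_ ?_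
  · exact measurable_dispatch he measurable_const
      (measurable_charge (measurable_settle he) (measurable_room hs)) measurable_const
  · refine measurable_dispatch he (measurable_pair measurable_const ?_) measurable_const hrelief
    unfold dotProduct
    fun_prop

end Measurability

/-! ### Feedback policies -/

/-- The storage levels when the decision rule `g`, which maps storage levels and net energies to an
action, is applied from slot `k` on to the net energies `f`. -/
def feedbackStorage (α : ℝ) (g : (Fin 2 → ℝ) → (Fin 2 → ℝ) → Action) (k : ℕ) (s : Fin 2 → ℝ)
    (f : ℕ → Fin 2 → ℝ) : ℕ → Fin 2 → ℝ
  | 0 => s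
  | t + 1 =>
    if k ≤ t then
      nextStorage α (feedbackStorage α g k s f t) (g (feedbackStorage α g k s f t) (f t))
    else s

/-- The net energies listed by a history, indexed by slots; the junk value is `0`. -/
def unhistory {t : ℕ} (h : Fin t → Fin 2 → ℝ) (n : ℕ) : Fin 2 → ℝ :=
  if hn : n - 1 < t then h ⟨n - 1, hn⟩ else 0

/-- The policy that applies the decision rule `g` in each slot. -/
def feedbackPolicy (α : ℝ) (g : (Fin 2 → ℝ) → (Fin 2 → ℝ) → Action) (k : ℕ) (s : Fin 2 → ℝ) :
    Policy :=
  fun t h => g (feedbackStorage α g k s (unhistory h) t) (unhistory h t)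

section Feedback

variable {α : ℝ} {g : (Fin 2 → ℝ) → (Fin 2 → ℝ) → Action} {k t : ℕ} {s : Fin 2 → ℝ}

theorem measurable_unhistory (n : ℕ) :
    Measurable fun h : Fin t → Fin 2 → ℝ => unhistory h n := by
  unfold unhistory
  split_ifs
  · exact measurable_pi_apply _
  · exact measurable_const

theorem measurable_feedbackStorage (hg : Measurable (Function.uncurry g)) {X : Type*}
    [MeasurableSpace X] {f : X → ℕ → Fin 2 → ℝ} (hf : ∀ n, Measurable fun x => f x n) (t : ℕ) :
    Measurable fun x => feedbackStorage α g k s (f x) t := by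
  induction t with
  | zero => exact measurable_const
  | succ t ih =>
    simp only [feedbackStorage]
    split_ifs
    · exact measurable_nextStorage ih (hg.comp (ih.prodMk (hf t)))
    · exact measurable_const

theorem measurable_feedbackPolicy (hg : Measurable (Function.uncurry g)) :
    (feedbackPolicy α g k s).Measurable := fun t =>
  measurable_action_iff.1 <| hg.comp <|
    (measurable_feedbackStorage hg measurable_unhistory t).prodMk (measurable_unhistory t)

theorem feedbackStorage_congr {f f' : ℕ → Fin 2 → ℝ} (h : ∀ n, k ≤ n → n < t → f n = f' n) :
    feedbackStorage α g k s f t = feedbackStorage α g k s f' t := by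
  induction t with
  | zero => rfl
  | succ t ih =>
    simp only [feedbackStorage]
    split_ifs with hk
    · rw [ih fun n hkn hnt => h n hkn (hnt.trans t.lt_succ_self), h t hk t.lt_succ_self]
    · rfl

variable {Ω : Type*} {E : ℕ → Ω → Fin 2 → ℝ} {ω : Ω}

theorem unhistory_history {n : ℕ} (hn : 1 ≤ n) (hnt : n ≤ t) :
    unhistory (history E t ω) n = E n ω := by
  simp [unhistory, history, show n - 1 < t by omega, Nat.sub_add_cancel hn]

theorem storage_feedbackPolicy (hk : 1 ≤ k) (t : ℕ) :
    storage α (feedbackPolicy α g k s) E k s ω t =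
      feedbackStorage α g k s (fun n => E n ω) t := by
  induction t with
  | zero => rfl
  | succ t ih =>
    simp only [storage, feedbackStorage, ih, Policy.act, feedbackPolicy]
    split_ifs with hkt
    · rw [unhistory_history (hk.trans hkt) le_rfl,
        feedbackStorage_congr fun n hkn hnt => unhistory_history (hk.trans hkn) hnt.le]
    · rfl

theorem act_feedbackPolicy (hk : 1 ≤ k) (hkt : k ≤ t) :
    (feedbackPolicy α g k s).act E t ω =
      g (storage α (feedbackPolicy α g k s) E k s ω t) (E t ω) := by
  rw [storage_feedbackPolicy hk, Policy.act, feedbackPolicy,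
    unhistory_history (hk.trans hkt) le_rfl,
    feedbackStorage_congr fun n hkn hnt => unhistory_history (hk.trans hkn) hnt.le]

end Feedback

/-! ### Optimality along sample paths -/

section Storage

variable {Ω : Type*} {α β S : ℝ} {i : Fin 2} {p q : Policy} {E : ℕ → Ω → Fin 2 → ℝ} {k n : ℕ}
  {s : Fin 2 → ℝ} {ω : Ω}

theorem storage_start : storage α p E k s ω k = s := by
  cases k <;> simp [storage]

theorem storage_succ (h : k ≤ n) :
    storage α p E k s ω (n + 1) = nextStorage α (storage α p E k s ω n) (p.act E n ω) :=
  if_pos h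

theorem storage_mem (hs : ∀ m, 0 ≤ s m ∧ s m ≤ S)
    (hp : ∀ t ∈ Finset.Ico k n,
      (∀ m, 0 ≤ storage α p E k s ω t m ∧ storage α p E k s ω t m ≤ S) →
        Feasible α β S (storage α p E k s ω t) (E t ω) (p.act E t ω))
    (hkn : k ≤ n) (m : Fin 2) :
    0 ≤ storage α p E k s ω n m ∧ storage α p E k s ω n m ≤ S := by
  induction n, hkn using Nat.le_induction generalizing m with
  | base => exact storage_start.symm ▸ hs m
  | succ n hkn ih =>
    have hact := hp n (Finset.mem_Ico.2 ⟨hkn, n.lt_succ_self⟩) <|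
      ih fun t ht => hp t (Finset.Ico_subset_Ico_right n.le_succ ht)
    rw [storage_succ hkn]
    exact ⟨hact.storage_nonneg m, hact.storage_le m⟩

theorem dominates_storage_of_isGreedyAction (hα : 0 ≤ α) (hαβ : α ≤ β) (hβ : β ≤ 1)
    (hs : ∀ m, 0 ≤ s m ∧ s m ≤ S) (he : ∀ t ∈ Finset.Ico k n, 0 ≤ E t ω i)
    (hp : ∀ t ∈ Finset.Ico k n,
      IsGreedyAction α β S (storage α p E k s ω t) (E t ω) (p.act E t ω))
    (hq : ∀ t ∈ Finset.Ico k n, Feasible α β S (storage α q E k s ω t) (E t ω) (q.act E t ω))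
    (hkn : k ≤ n) :
    Dominates (shadowPrices α β i)
      (∑ t ∈ Finset.Ico k n, (q.act E t ω).grid - ∑ t ∈ Finset.Ico k n, (p.act E t ω).grid)
      (storage α p E k s ω n) (storage α q E k s ω n) := by
  induction n, hkn using Nat.le_induction with
  | base =>
    simp only [storage_start, Finset.Ico_self, Finset.sum_empty, sub_self]
    exact Dominates.refl _ s
  | succ n hkn ih =>
    have hsub : Finset.Ico k n ⊆ Finset.Ico k (n + 1) := Finset.Ico_subset_Ico_right n.le_succ
    have hn : n ∈ Finset.Ico k (n + 1) := Finset.mem_Ico.2 ⟨hkn, n.lt_succ_self⟩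
    have hmem := storage_mem hs (fun t ht _ => (hp t (hsub ht)).1) hkn
    have hdom := ih (fun t ht => he t (hsub ht)) (fun t ht => hp t (hsub ht))
      (fun t ht => hq t (hsub ht))
    rw [storage_succ hkn, storage_succ hkn, Finset.sum_Ico_succ_top hkn,
      Finset.sum_Ico_succ_top hkn]
    convert hdom.step_of_isGreedyAction hα hαβ hβ hmem (he n hn) (hp n hn) (hq n hn) using 1
    ring

end Storage

section Optimality

variable {Ω : Type*} [MeasurableSpace Ω] {μ : Measure Ω} {α β S : ℝ} {i : Fin 2} {p : Policy}
  {E : ℕ → Ω → Fin 2 → ℝ} {k N : ℕ} {s : Fin 2 → ℝ}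

/-- `p` is admissible and, almost surely, has at every horizon up to `N` drawn no more conventional
energy since slot `k` than any given admissible policy. -/
def IsPathwiseOptimal (α β S : ℝ) (N : ℕ) (μ : Measure Ω) (E : ℕ → Ω → Fin 2 → ℝ) (k : ℕ)
    (s : Fin 2 → ℝ) (p : Policy) : Prop :=
  Admissible α β S N μ E k s p ∧ ∀ q, Admissible α β S N μ E k s q → ∀ᵐ ω ∂μ, ∀ n ≤ N,
    ∑ t ∈ Finset.Icc k n, (p.act E t ω).grid ≤ ∑ t ∈ Finset.Icc k n, (q.act E t ω).grid

theorem IsPathwiseOptimal.isOptimal (h : IsPathwiseOptimal α β S N μ E k s p) :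
    IsOptimal α β S N μ E k s p :=
  ⟨h.1, fun q hq => lintegral_mono_ae <|
    (h.2 q hq).mono fun _ hω => ENNReal.ofReal_le_ofReal (hω N le_rfl)⟩

theorem IsGreedy.isPathwiseOptimal (hα : 0 ≤ α) (hαβ : α ≤ β) (hβ : β ≤ 1)
    (hs : ∀ m, 0 ≤ s m ∧ s m ≤ S) (he : ∀ t ∈ Finset.Icc k N, ∀ᵐ ω ∂μ, 0 ≤ E t ω i)
    (hp : IsGreedy α β S N μ E k s p) : IsPathwiseOptimal α β S N μ E k s p := by
  refine ⟨⟨hp.1, fun t ht => (hp.2 t ht).mono fun ω h => h.1⟩, fun q hq => ?_⟩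
  filter_upwards [(Finset.eventually_all _).2 he, (Finset.eventually_all _).2 hp.2,
    (Finset.eventually_all _).2 hq.2] with ω he hp hq n hn
  rcases lt_or_ge n k with hnk | hkn
  · simp [hnk]
  have hsub : Finset.Ico k (n + 1) ⊆ Finset.Icc k N := by
    rw [Finset.Ico_add_one_right_eq_Icc]
    exact Finset.Icc_subset_Icc_right hn
  rw [← Finset.Ico_add_one_right_eq_Icc, ← sub_nonneg]
  exact (dominates_storage_of_isGreedyAction hα hαβ hβ hs (fun t ht => he t (hsub ht))
    (fun t ht => hp t (hsub ht)) (fun t ht => hq t (hsub ht)) (hkn.trans n.le_succ)).nonneg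

theorem exists_isGreedy_exclusive (hα : 0 ≤ α) (hαβ : α ≤ β) (hβ : β ≤ 1)
    (hs : ∀ m, 0 ≤ s m ∧ s m ≤ S) (hk : 1 ≤ k)
    (he : ∀ t ∈ Finset.Icc k N, ∀ᵐ ω ∂μ, 0 ≤ E t ω i) :
    ∃ p : Policy, IsGreedy α β S N μ E k s p ∧
      ∀ t ∈ Finset.Icc k N, ∀ᵐ ω ∂μ, (p.act E t ω).Exclusive := by
  have hβ0 : 0 ≤ β := hα.trans hαβ
  set p := feedbackPolicy α (greedyAction α β S i) k s
  have hmem : ∀ t ∈ Finset.Icc k N, ∀ᵐ ω ∂μ,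
      ∀ m, 0 ≤ storage α p E k s ω t m ∧ storage α p E k s ω t m ≤ S := by
    intro t ht
    filter_upwards [(Finset.eventually_all _).2 he] with ω he
    refine storage_mem (β := β) hs (fun n hn hbox => ?_) (Finset.mem_Icc.1 ht).1
    have hnN : n ∈ Finset.Icc k N := Finset.Ico_subset_Icc_self <|
      Finset.Ico_subset_Ico_right (Finset.mem_Icc.1 ht).2 hn
    rw [act_feedbackPolicy hk (Finset.mem_Ico.1 hn).1]
    exact greedyAction_feasible hα hβ0 hbox (he n hnN)
  have hmeasurable : Measurable (Function.uncurry (greedyAction α β S i)) :=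
    measurable_greedyAction measurable_fst measurable_snd
  refine ⟨p, ⟨measurable_feedbackPolicy hmeasurable, fun t ht => ?_⟩, fun t ht => ?_⟩ <;>
    filter_upwards [he t ht, hmem t ht] with ω het hbox <;>
    rw [act_feedbackPolicy hk (Finset.mem_Icc.1 ht).1]
  · exact isGreedyAction_greedyAction hα hαβ hβ hbox het
  · exact greedyAction_exclusive hα hβ0 hbox het

end Optimality

end EnergyCoop

theorem mainTheorem3_general {Ω : Type*} [MeasurableSpace Ω] (μ : Measure Ω) {α β S : ℝ}
    (hα : 0 ≤ α) (hαβ : α ≤ β) (hβ : β ≤ 1) {N : ℕ} {E : ℕ → Ω → Fin 2 → ℝ} {k : ℕ} (hk : 1 ≤ k)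
    (i : Fin 2) (he : ∀ t ∈ Finset.Icc k N, ∀ᵐ ω ∂μ, 0 ≤ E t ω i)
    {s : Fin 2 → ℝ} (hs : ∀ m, 0 ≤ s m ∧ s m ≤ S) :
    (∃ p : EnergyCoop.Policy, EnergyCoop.IsGreedy α β S N μ E k s p ∧
      ∀ t ∈ Finset.Icc k N, ∀ᵐ ω ∂μ, (p.act E t ω).Exclusive) ∧
    ∀ p : EnergyCoop.Policy, EnergyCoop.IsGreedy α β S N μ E k s p →
      EnergyCoop.IsPathwiseOptimal α β S N μ E k s p :=
  ⟨EnergyCoop.exists_isGreedy_exclusive hα hαβ hβ hs hk he,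
    fun _ hp => hp.isPathwiseOptimal hα hαβ hβ hs he⟩

theorem mainTheorem3 {Ω : Type*} [MeasurableSpace Ω] (μ : Measure Ω) [IsProbabilityMeasure μ]
    (α β Smax : ℝ) (hα : 0 ≤ α) (hαβ : α < β) (hβ : β ≤ 1) (hS : 0 ≤ Smax)
    (N : ℕ) (E : ℕ → Ω → Fin 2 → ℝ) (hE : ∀ t, Measurable (E t))
    (hpos : (∀ t ∈ Finset.Icc 1 N, ∀ᵐ ω ∂μ, 0 ≤ E t ω 0) ∨
      (∀ t ∈ Finset.Icc 1 N, ∀ᵐ ω ∂μ, 0 ≤ E t ω 1))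
    (k : ℕ) (hk : k ∈ Finset.Icc 1 N)
    (s : Fin 2 → ℝ) (hs : ∀ i, 0 ≤ s i ∧ s i ≤ Smax) :
    (∃ p : EnergyCoop.Policy, EnergyCoop.IsGreedy α β Smax N μ E k s p ∧
      ∀ t ∈ Finset.Icc k N, ∀ᵐ ω ∂μ, (p.act E t ω).Exclusive) ∧
    (∀ p : EnergyCoop.Policy, EnergyCoop.IsGreedy α β Smax N μ E k s p →
      EnergyCoop.IsOptimal α β Smax N μ E k s p) := by
  obtain ⟨hk1, -⟩ := Finset.mem_Icc.1 hk
  obtain ⟨i, he⟩ : ∃ i, ∀ t ∈ Finset.Icc k N, ∀ᵐ ω ∂μ, 0 ≤ E t ω i :=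
    hpos.elim (fun h => ⟨0, fun t ht => h t (Finset.Icc_subset_Icc_left hk1 ht)⟩)
      fun h => ⟨1, fun t ht => h t (Finset.Icc_subset_Icc_left hk1 ht)⟩
  exact (mainTheorem3_general μ hα hαβ.le hβ hk1 i he hs).imp_right
    fun h p hp => (h p hp).isOptimal
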